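/- Let $\mu$ be a non-atomic Borel probability measure on a standard Borel space $X$, and let $L^0(\mu,\mathbb T)$ be the group of $\mu$-classes of Borel functions from $X$ to the unit circle, with pointwise multiplication and the topology of convergence in measure. Let $S$ be the set of all non-empty finite sequences $\kappa=(\kappa(1)\le\dots\le\kappa(n))$ of non-zero integers, and write $|\kappa|=n$. For $\kappa\in S$ and $i\in\{1,2,\dots\}$ let $\lambda^i_\kappa$ be a finite Borel measure on $X^{|\kappa|}$ whose marginals are absolutely continuous with respect to $\mu$, such that $\lambda^i_\kappa(\{x: x_a=x_b\})=0$ for $a<b$, and $\lambda^j_\kappa\ll\lambda^i_\kappa$ for $i<j$. Let $\sigma(\kappa,\lambda^i_\kappa)$ be the unitary representation of $L^0(\mu,\mathbb T)$ on $L^2(\lambda^i_\kappa)$ in which $f$ acts as multiplication by $f^\kappa(x)=\prod_{a\le|\kappa|}f(x_a)^{\kappa(a)}$. Let $\Phi$ be a strongly continuous unitary representation of $L^0(\mu,\mathbb T)$ on a separable complex Hilbert space $H$ that is (unitarily equivalent to) $\bigoplus_{\kappa\in S,\,i\ge1}\sigma(\kappa,\lambda^i_\kappa)$. For a unitary operator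 $u$ on $H$ the spectral measure of $h\in H$ is the finite Borel measure $\sigma_h$ on $\mathbb T$ with $\langle u^kh,h\rangle=\int z^k\,d\sigma_h$ for all $k\in\mathbb Z$; the maximal spectral type $\sigma_u$ is a spectral measure of some vector with respect to which the spectral measures of all vectors are absolutely continuous (unique up to mutual absolute continuity). Let $K$ be either the set of positive integers or the set of non-zero integers. The following are equivalent. 1. (The DL-condition with coefficients in $K$; for $K=\mathbb Z^+$ this is the DL-condition.) There is a dense $G_\delta$ set $G\subseteq L^0(\mu,\mathbb T)$ such that for every $f\in G$, all $l,l'\ge1$, and all tuples $(k(1),\dots,k(l))$ and $(k'(1),\dots,k'(l'))$ of elements of $K$ that are not rearrangements of each other, $$\sigma_{\Phi(f)^{k(1)}}*\cdots*\sigma_{\Phi(f)^{k(l)}}\ \perp\ \sigma_{\Phi(f)^{k'(1)}}*\cdots*\sigma_{\Phi(f)^{k'(l')}}.$$ 2. (The orthogonality relations with coefficients in $K$.) For all $l,l'\ge1$, all $\kappa_1,\dots,\kappa_l,\kappa'_1,\dots,\kappa'_{l'}\in S$ with $|\kappa_1|+\dots+|\kappa_l|=|\kappa'_1|+\dots+|\kappa'_{l'}|=t$,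 and every permutation $r$ of $\{1,\dots,t\}$, $$\lambda^1_{\kappa_1}\times\cdots\times\lambda^1_{\kappa_l}\ \perp\ r\big(\lambda^1_{\kappa'_1}\times\cdots\times\lambda^1_{\kappa'_{l'}}\big)$$ whenever $$k(1)\kappa_1+\cdots+k(l)\kappa_l=r\big(k'(1)\kappa'_1+\cdots+k'(l')\kappa'_{l'}\big)$$ for some tuples $(k(1),\dots,k(l))$ and $(k'(1),\dots,k'(l'))$ of elements of $K$ that are not rearrangements of each other. Here $+$ denotes concatenation of sequences, $d\kappa$ is the sequence with entries $d\kappa(a)$, and $r$ acts on points of $X^t$ and on $\mathbb Z^t$ by $(x_1,\dots,x_t)\mapsto(x_{r(1)},\dots,x_{r(t)})$ and on measures on $X^t$ by push-forward along this map. -/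

import Mathlib

open MeasureTheory

noncomputable section

namespace SpectralDL

/-- The Borel `σ`-algebra of the unit circle. -/
instance instMeasurableSpaceCircle : MeasurableSpace Circle := borel Circle

instance instBorelSpaceCircle : BorelSpace Circle := ⟨rfl⟩

/-! ### The group `L⁰(μ, 𝕋)` with the topology of convergence in measure

`X →ₘ[μ] Circle` is Mathlib's group of `μ`-classes of measurable functions into the unit circle.
Its topology is the one with basis the balls `{f | ∫ |f - f₀| dμ < ε}`; since the functions are
bounded by `1` and `μ` is finite, this is convergence in measure. -/

theorem integrable_norm_sub {X : Type*} [MeasurableSpace X] {μ : Measure X} [IsFiniteMeasure μ]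
    (f g : X →ₘ[μ] Circle) : Integrable (fun x => ‖(f x : ℂ) - (g x : ℂ)‖) μ := by
  have hf : AEStronglyMeasurable (fun x => (f x : ℂ)) μ :=
    continuous_subtype_val.comp_aestronglyMeasurable f.aestronglyMeasurable
  have hg : AEStronglyMeasurable (fun x => (g x : ℂ)) μ :=
    continuous_subtype_val.comp_aestronglyMeasurable g.aestronglyMeasurable
  refine ((Integrable.of_bound hf 1 ?_).sub (Integrable.of_bound hg 1 ?_)).norm <;>
    exact Filter.Eventually.of_forall fun x => (Circle.norm_coe _).le

instance instMetricSpaceL0 {X : Type*} [MeasurableSpace X] {μ : Measure X} [IsFiniteMeasure μ] :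
    MetricSpace (X →ₘ[μ] Circle) where
  dist f g := ∫ x, ‖(f x : ℂ) - (g x : ℂ)‖ ∂μ
  dist_self f := by simp
  dist_comm f g := by simp only [norm_sub_rev]
  dist_triangle f g h := by
    rw [← integral_add (integrable_norm_sub f g) (integrable_norm_sub g h)]
    exact integral_mono (integrable_norm_sub f h)
      ((integrable_norm_sub f g).add (integrable_norm_sub g h))
      (fun x => norm_sub_le_norm_sub_add_norm_sub _ _ _)
  eq_of_dist_eq_zero {f g} h := by
    have h0 := (integral_eq_zero_iff_of_nonneg (fun x => norm_nonneg _)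
      (integrable_norm_sub f g)).1 h
    refine AEEqFun.ext ?_
    filter_upwards [h0] with x hx
    exact Circle.ext (sub_eq_zero.1 (norm_eq_zero.1 hx))

/-- A homomorphism into the unitary group of `H` is continuous for the strong operator topology,
i.e. for pointwise convergence on `H`. -/
def StronglyContinuous {G H : Type*} [Group G] [TopologicalSpace G] [NormedAddCommGroup H]
    [InnerProductSpace ℂ H] [CompleteSpace H] (Φ : G →* unitary (H →L[ℂ] H)) : Prop :=
  ∀ v : H, Continuous fun g => (Φ g : H →L[ℂ] H) v

/-! ### Spectral measures, maximal spectral type, convolutions -/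

/-- `σ` is the spectral measure of the vector `h` for the unitary operator `u`: it is a finite
Borel measure on the circle with `⟨uᵏ h, h⟩ = ∫ zᵏ dσ(z)` for every integer `k`
(Mathlib's inner product is linear in its second argument). -/
def IsSpectralMeasure {H : Type*} [NormedAddCommGroup H] [InnerProductSpace ℂ H]
    [CompleteSpace H] (u : unitary (H →L[ℂ] H)) (h : H) (σ : Measure Circle) : Prop :=
  IsFiniteMeasure σ ∧
    ∀ k : ℤ, inner ℂ h (((u ^ k : unitary (H →L[ℂ] H)) : H →L[ℂ] H) h)
      = ∫ z : Circle, (z : ℂ) ^ k ∂σ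

/-- `σ` represents the maximal spectral type of `u`: it is the spectral measure of some vector, and
the spectral measure of every vector is absolutely continuous with respect to it. Such a `σ` exists
on a separable Hilbert space and is unique up to mutual absolute continuity. -/
def IsMaximalSpectralType {H : Type*} [NormedAddCommGroup H] [InnerProductSpace ℂ H]
    [CompleteSpace H] (u : unitary (H →L[ℂ] H)) (σ : Measure Circle) : Prop :=
  (∃ h : H, IsSpectralMeasure u h σ) ∧
    ∀ (v : H) (ρ : Measure Circle), IsSpectralMeasure u v ρ → ρ ≪ σ

/-- The convolution `σ₁ ∗ ⋯ ∗ σ_l` of measures on the circle: the image of the product measure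
under multiplication. -/
def convolution {l : ℕ} (σ : Fin l → Measure Circle) : Measure Circle :=
  (Measure.pi σ).map fun z => ∏ i, z i

/-- The tuple `k'` is a rearrangement of the tuple `k`; in particular they have equal length. -/
def IsRearrangement {l l' : ℕ} (k : Fin l → ℤ) (k' : Fin l' → ℤ) : Prop :=
  ∃ s : Fin l' ≃ Fin l, ∀ j, k' j = k (s j)

/-- The DL-condition with coefficients in a set `K` of integers: for all `f` in a dense `G_δ` set,
the convolutions of the maximal spectral types of `Φ(f)^{k(1)}, …, Φ(f)^{k(l)}` and of
`Φ(f)^{k'(1)}, …, Φ(f)^{k'(l')}` are mutually singular, for all nonempty tuples `k`, `k'` with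
entries in `K` that are not rearrangements of each other. -/
def DLCondition (K : Set ℤ) {X : Type*} [MeasurableSpace X] {μ : Measure X} [IsFiniteMeasure μ]
    {H : Type*} [NormedAddCommGroup H] [InnerProductSpace ℂ H] [CompleteSpace H]
    (Φ : (X →ₘ[μ] Circle) →* unitary (H →L[ℂ] H)) : Prop :=
  ∃ G : Set (X →ₘ[μ] Circle), IsGδ G ∧ Dense G ∧
    ∀ f ∈ G, ∀ (l l' : ℕ) (k : Fin l → ℤ) (k' : Fin l' → ℤ), 0 < l → 0 < l' →
      (∀ i, k i ∈ K) → (∀ j, k' j ∈ K) → ¬ IsRearrangement k k' →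
      ∀ (σ : Fin l → Measure Circle) (σ' : Fin l' → Measure Circle),
        (∀ i, IsMaximalSpectralType (Φ f ^ k i) (σ i)) →
        (∀ j, IsMaximalSpectralType (Φ f ^ k' j) (σ' j)) →
        (convolution σ).MutuallySingular (convolution σ')

/-! ### The representations `σ(κ, λ)` and their direct sums -/

/-- The set `S` of nonempty nondecreasing finite sequences of non-zero integers. -/
structure Weight where
  /-- the length `|κ|` -/
  len : ℕ
  len_pos : 0 < len
  /-- the entries -/
  entry : Fin len → ℤ
  entry_ne_zero : ∀ j, entry j ≠ 0
  monotone_entry : Monotone entry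

/-- `f^κ(x₁, …, x_n) = ∏ f(x_j)^{k(j)}` as a complex number. It depends on the representative of
`f` only up to null sets of measures whose marginals are absolutely continuous with respect to
`μ`. -/
def powWeight {X : Type*} [MeasurableSpace X] {μ : Measure X} (f : X →ₘ[μ] Circle) (κ : Weight)
    (x : Fin κ.len → X) : ℂ :=
  ((∏ j, f (x j) ^ κ.entry j : Circle) : ℂ)

/-- The conditions on the measures `λ_κ^i` on `X^{|κ|}`, `i = 1, 2, …`, of Solecki's form. -/
structure IsSoleckiFamily {X : Type*} [MeasurableSpace X] (μ : Measure X)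
    (lam : (κ : Weight) → ℕ+ → Measure (Fin κ.len → X)) : Prop where
  finite : ∀ κ i, IsFiniteMeasure (lam κ i)
  marginal : ∀ κ i (j : Fin κ.len), (lam κ i).map (fun x => x j) ≪ μ
  diagonal : ∀ κ i (a b : Fin κ.len), a < b → lam κ i {x | x a = x b} = 0
  decreasing : ∀ κ (i j : ℕ+), i < j → lam κ j ≪ lam κ i

/-- `Φ` is (unitarily equivalent to) the Hilbert space direct sum of the representations
`σ(κ, λ_κ^i)`: there is an isometric isomorphism of `H` with the `ℓ²`-sum of the spaces
`L²(λ_κ^i)` carrying `Φ(f)` to multiplication by `f^κ` in the summand indexed by `(κ, i)`. -/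
def IsDirectSumOfMultiplications {X : Type*} [MeasurableSpace X] {μ : Measure X}
    {H : Type*} [NormedAddCommGroup H] [InnerProductSpace ℂ H] [CompleteSpace H]
    (Φ : (X →ₘ[μ] Circle) →* unitary (H →L[ℂ] H))
    (lam : (κ : Weight) → ℕ+ → Measure (Fin κ.len → X)) : Prop :=
  ∃ U : H ≃ₗᵢ[ℂ] lp (fun p : Weight × ℕ+ => Lp ℂ 2 (lam p.1 p.2)) 2,
    ∀ (f : X →ₘ[μ] Circle) (v : H) (κ : Weight) (i : ℕ+),
      ⇑(U ((Φ f : H →L[ℂ] H) v) (κ, i)) =ᵐ[lam κ i]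
        fun x => powWeight f κ x * (U v (κ, i) : (Fin κ.len → X) → ℂ) x

/-! ### The orthogonality relations

The coordinates of `X^t`, `t = |κ₁| + ⋯ + |κ_l|`, are indexed by the pairs `(i, a)` with `i ≤ l` and
`a ≤ |κ_i|`. Accordingly, an element of `S_t` relating two such decompositions of `t` is a bijection
between the two index sets (which exists exactly when the total lengths agree). -/

/-- The index set of the coordinates of the concatenation of `κ₁, …, κ_l`. -/
abbrev ConcatIndex {l : ℕ} (κ : Fin l → Weight) : Type := Σ i : Fin l, Fin (κ i).len

/-- The concatenation `k(1)κ₁ + ⋯ + k(l)κ_l`. -/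
def concat {l : ℕ} (k : Fin l → ℤ) (κ : Fin l → Weight) : ConcatIndex κ → ℤ :=
  fun p => k p.1 * (κ p.1).entry p.2

/-- The product measure `λ_{κ₁}^1 × ⋯ × λ_{κ_l}^1` on `X^t`. -/
def prodMeasure {X : Type*} [MeasurableSpace X]
    (lam : (κ : Weight) → ℕ+ → Measure (Fin κ.len → X)) {l : ℕ} (κ : Fin l → Weight) :
    Measure (ConcatIndex κ → X) :=
  (Measure.pi fun i => lam (κ i) 1).map fun y p => y p.1 p.2

/-- The orthogonality relations with coefficients in a set `K` of integers. A bijection `r` acts on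
points, tuples and measures by permuting coordinates, `(x_p)_p ↦ (x_{r(p)})_p`. -/
def OrthogonalityRelations (K : Set ℤ) {X : Type*} [MeasurableSpace X]
    (lam : (κ : Weight) → ℕ+ → Measure (Fin κ.len → X)) : Prop :=
  ∀ (l l' : ℕ) (κ : Fin l → Weight) (κ' : Fin l' → Weight)
    (r : ConcatIndex κ ≃ ConcatIndex κ') (k : Fin l → ℤ) (k' : Fin l' → ℤ), 0 < l → 0 < l' →
    (∀ i, k i ∈ K) → (∀ j, k' j ∈ K) → ¬ IsRearrangement k k' →
    (∀ p, concat k κ p = concat k' κ' (r p)) →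
    (prodMeasure lam κ).MutuallySingular
      ((prodMeasure lam κ').map fun (x : ConcatIndex κ' → X) p => x (r p))

end SpectralDL

end

/-! Both directions rest on computing spectral measures. By Fourier uniqueness, the spectral measure
of `v` for `Φ(f)^k` is the sum, over the summands, of the images of `|v|² dλ` under `f^{kκ}`. Hence
the maximal spectral type is equivalent to the sum over `κ` of the images of `λ_κ^1`, the other `i`
being absorbed by `λ_κ^i ≪ λ_κ^1`. A convolution of such images is the image of a product measure
under `f^α`, where `α` is the concatenated weight (`convolution_weightMeasure`).

From DL to orthogonality, a single `f` suffices. If `α = β ∘ r`, then `f^β` is `f^α` after permuting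
coordinates, so a set separating the images on the circle pulls back to one separating the measures
on `X^t`.

The converse is a Baire category argument (`dense_separating`,
`eventually_residual_mutuallySingular`). Approximate any `f₀` by a step function whose values on the
cells of a fine partition are multiplicatively independent. If `x` and `y` each have coordinates in
distinct cells, then `f^α(x) = f^β(y)` forces a bijection `r` with `α = β ∘ r` that matches the
cells of `x` with those of `y`. The relations make `A` singular to every such rearrangement of `B`,
so a union of cells nearly separates them, and the images are nearly singular. Near singularity is
an open condition on `f`, and there are only countably many tuples and weights. -/

namespace SpectralDL

open Set Filter Topology
open scoped NNReal ENNReal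

/-! ### Finite measures on the circle are determined by their Fourier coefficients -/

/-- The character `z ↦ zⁿ` of the circle, as a bounded continuous function. -/
noncomputable def circleMonomial (n : ℤ) : BoundedContinuousFunction Circle ℂ :=
  BoundedContinuousFunction.mkOfCompact
    ⟨fun z => ((z ^ n : Circle) : ℂ), continuous_subtype_val.comp (continuous_zpow n)⟩

theorem circleMonomial_apply (n : ℤ) (z : Circle) : circleMonomial n z = (z : ℂ) ^ n := by
  simp [circleMonomial]

/-- The star subalgebra of trigonometric polynomials. -/
noncomputable def circlePolynomials : StarSubalgebra ℂ (BoundedContinuousFunction Circle ℂ) where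
  toSubalgebra := Algebra.adjoin ℂ (range circleMonomial)
  star_mem' := by
    change Algebra.adjoin ℂ (range circleMonomial) ≤ star (Algebra.adjoin ℂ (range circleMonomial))
    refine Algebra.adjoin_le ?_
    rintro - ⟨n, rfl⟩
    refine Algebra.subset_adjoin ⟨-n, ?_⟩
    ext z
    simp [circleMonomial_apply, ← Circle.coe_inv_eq_conj]

/-- Characters are closed under multiplication, so the algebra they generate is just their span. -/
theorem circlePolynomials_coe :
    Subalgebra.toSubmodule circlePolynomials.toSubalgebra
      = Submodule.span ℂ (range circleMonomial) := by
  apply Algebra.adjoin_eq_span_of_subset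
  refine Subset.trans ?_ Submodule.subset_span
  intro x hx
  refine Submonoid.closure_induction (fun _ => id) ⟨0, ?_⟩ ?_ hx
  · ext z; simp [circleMonomial_apply]
  · rintro - - - - ⟨m, rfl⟩ ⟨n, rfl⟩
    refine ⟨m + n, ?_⟩
    ext z
    simp [circleMonomial_apply, zpow_add₀]

theorem measure_circle_ext {a b : Measure Circle} [IsFiniteMeasure a] [IsFiniteMeasure b]
    (h : ∀ n : ℤ, ∫ z : Circle, (z : ℂ) ^ n ∂a = ∫ z : Circle, (z : ℂ) ^ n ∂b) : a = b := by
  refine ext_of_forall_mem_subalgebra_integral_eq_of_pseudoEMetric_complete_countable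
    (𝕜 := ℂ) (A := circlePolynomials) ?_ ?_
  · intro x y hxy
    refine ⟨_, ⟨BoundedContinuousFunction.toContinuousMapStarₐ ℂ (circleMonomial 1),
      ⟨circleMonomial 1, Algebra.subset_adjoin ⟨1, rfl⟩, rfl⟩, rfl⟩, ?_⟩
    have h1 : ∀ z : Circle, (BoundedContinuousFunction.toContinuousMapStarₐ ℂ
        (circleMonomial 1)) z = (z : ℂ) := fun z => by
      simpa using circleMonomial_apply 1 z
    exact fun h => hxy (Circle.ext (by simpa only [h1] using h))
  · intro g hg
    have hg' : g ∈ Submodule.span ℂ (range circleMonomial) := by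
      rw [← circlePolynomials_coe]; exact hg
    induction hg' using Submodule.span_induction with
    | mem x hx =>
      obtain ⟨n, rfl⟩ := hx
      simpa only [circleMonomial_apply] using h n
    | zero => simp
    | add x y hx hy ihx ihy =>
      have hx' : x ∈ circlePolynomials := by
        have := circlePolynomials_coe ▸ hx
        exact this
      have hy' : y ∈ circlePolynomials := by
        have := circlePolynomials_coe ▸ hy
        exact this
      simp only [BoundedContinuousFunction.coe_add, Pi.add_apply]
      rw [integral_add (x.integrable _) (y.integrable _),
        integral_add (x.integrable _) (y.integrable _), ihx hx', ihy hy']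
    | smul c x hx ih =>
      have hx' : x ∈ circlePolynomials := by
        have := circlePolynomials_coe ▸ hx
        exact this
      simp only [BoundedContinuousFunction.coe_smul]
      rw [integral_smul, integral_smul, ih hx']

/-! ### Products of sums of measures -/

/-- Split off one factor and use that products distribute over countable sums. It passes from a type
dominated by a sum over weights to a convolution dominated by a sum over tuples of weights. -/
theorem pi_absolutelyContinuous_sum {ι : Type*} [Countable ι] :
    ∀ {l : ℕ} {Y : Fin l → Type*} [∀ i, MeasurableSpace (Y i)] (σ : ∀ i, Measure (Y i))
      (τ : ∀ i, ι → Measure (Y i)) [∀ i, IsFiniteMeasure (σ i)]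
      [∀ i j, IsFiniteMeasure (τ i j)], (∀ i, σ i ≪ Measure.sum (τ i)) →
      Measure.pi σ ≪ Measure.sum fun p : Fin l → ι => Measure.pi fun i => τ i (p i) := by
  intro l
  induction l with
  | zero =>
    intro Y _ σ τ _ _ h
    refine Measure.AbsolutelyContinuous.mk fun s hs h0 => ?_
    rw [Measure.sum_apply _ hs, ENNReal.tsum_eq_zero] at h0
    rw [← h0 finZeroElim, Measure.pi_of_empty σ, Measure.pi_of_empty]
  | succ l ih =>
    intro Y _ σ τ _ _ h
    have e1 := (measurePreserving_piFinSuccAbove σ 0)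
    have ih' := ih (fun j => σ (Fin.succAbove 0 j)) (fun j => τ (Fin.succAbove 0 j))
      fun j => h _
    have hp := (h 0).prod ih'
    rw [Measure.prod_sum] at hp
    refine Measure.AbsolutelyContinuous.mk fun s hs h0 => ?_
    rw [Measure.sum_apply _ hs, ENNReal.tsum_eq_zero] at h0
    rw [← (e1.symm _).map_eq, MeasurableEquiv.map_apply]
    refine hp ?_
    rw [Measure.sum_apply _ ((MeasurableEquiv.measurable _) hs), ENNReal.tsum_eq_zero]
    rintro ⟨i, p⟩
    have e2 := (measurePreserving_piFinSuccAbove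
      (fun j => τ j ((Fin.cons i p : Fin (l + 1) → ι) j)) 0)
    have := h0 (Fin.cons i p)
    rw [← (e2.symm _).map_eq, MeasurableEquiv.map_apply] at this
    simpa using this

theorem pi_absolutelyContinuous {l : ℕ} {Y : Fin l → Type*} [∀ i, MeasurableSpace (Y i)]
    (σ τ : ∀ i, Measure (Y i)) [∀ i, IsFiniteMeasure (σ i)]
    [∀ i, IsFiniteMeasure (τ i)] (h : ∀ i, σ i ≪ τ i) : Measure.pi σ ≪ Measure.pi τ := by
  have := pi_absolutelyContinuous_sum (ι := Unit) σ (fun i _ => τ i) fun i => by simpa using h i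
  simpa using this

/-! ### A criterion for mutual singularity -/

/-- Integrating `g + h = 1` against `a ⊓ b` bounds its mass by an arbitrarily small number.
Continuous test functions, rather than sets, are what make the condition open in `f` later. -/
theorem mutuallySingular_of_forall_continuous {Y : Type*} [MeasurableSpace Y] [TopologicalSpace Y]
    [BorelSpace Y] {a b : Measure Y}
    (h : ∀ ε : ℝ≥0∞, 0 < ε → ∃ g h : C(Y, ℝ≥0), g + h = 1 ∧
      ∫⁻ y, g y ∂a < ε ∧ ∫⁻ y, h y ∂b < ε) : a ⟂ₘ b := by
  refine Measure.mutuallySingular_of_disjoint (disjoint_iff_inf_le.2 ?_)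
  set ξ := a ⊓ b
  have h0 : ξ univ = 0 := by
    refine nonpos_iff_eq_zero.1 (le_of_forall_pos_le_add fun ε hε => ?_)
    obtain ⟨g, g', hg, ha, hb⟩ := h (ε / 2) (ENNReal.half_pos hε.ne')
    calc ξ univ = ∫⁻ y, (g y + g' y : ℝ≥0∞) ∂ξ := by
          rw [← lintegral_one]
          refine lintegral_congr fun y => ?_
          rw [← ENNReal.coe_add, ← ContinuousMap.add_apply, hg]; simp
      _ = ∫⁻ y, g y ∂ξ + ∫⁻ y, g' y ∂ξ :=
          lintegral_add_left (by have := g.continuous; fun_prop) _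
      _ ≤ ∫⁻ y, g y ∂a + ∫⁻ y, g' y ∂b :=
          add_le_add (lintegral_mono' inf_le_left le_rfl) (lintegral_mono' inf_le_right le_rfl)
      _ ≤ ε / 2 + ε / 2 := add_le_add ha.le hb.le
      _ = 0 + ε := by rw [ENNReal.add_halves, zero_add]
  rw [Measure.measure_univ_eq_zero] at h0
  rw [h0]; exact bot_le

/-! ### Multiplicatively independent points of the circle -/

theorem Circle.finite_zpow_eq {n : ℤ} (hn : n ≠ 0) (w : Circle) :
    {z : Circle | z ^ n = w}.Finite := by
  wlog hp : 0 < n generalizing n w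
  · have := this (n := -n) (by omega) w⁻¹ (by omega)
    simpa using this
  lift n to ℕ using hp.le
  have hn' : 0 < n := by omega
  refine Finite.of_finite_image (f := fun z : Circle => (z : ℂ)) ?_
    (Circle.coe_injective.injOn)
  refine (Multiset.finite_toSet (Polynomial.nthRoots n (w : ℂ))).subset ?_
  rintro _ ⟨z, hz, rfl⟩
  have hz' : z ^ n = w := by simpa using hz
  simp [Polynomial.mem_nthRoots hn', ← hz']

instance Circle.nhdsNE_neBot (z : Circle) : (𝓝[≠] z).NeBot := by
  have : Nontrivial Circle := ⟨1, -1, fun h => by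
    have h' := congrArg (fun z : Circle => (z : ℂ)) h
    norm_num [Complex.ext_iff] at h'⟩
  infer_instance

/-- Families of points of the circle without multiplicative relations are dense. -/
theorem dense_multiplicativelyIndependent (C : Type*) [Fintype C] :
    Dense {c : C → Circle | ∀ v : C → ℤ, ∏ j, c j ^ v j = 1 → v = 0} := by
  classical
  have hset : {c : C → Circle | ∀ v : C → ℤ, ∏ j, c j ^ v j = 1 → v = 0}
      = ⋂ v : {v : C → ℤ // v ≠ 0}, {c | ∏ j, c j ^ v.1 j = 1}ᶜ := by
    ext c
    simp only [mem_ofPred_eq, mem_iInter, mem_compl_iff, Subtype.forall]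
    exact forall_congr' fun v => not_imp_not.symm
  rw [hset]
  refine dense_iInter_of_isOpen (fun v => ?_) fun v => ?_
  · refine (isClosed_eq (by fun_prop) continuous_const).isOpen_compl
  · obtain ⟨v, hv⟩ := v
    obtain ⟨j, hj⟩ := Function.ne_iff.1 hv
    -- Move only the coordinate `j`, where the exponent is non-zero: the relation then fixes `z ^ v
    -- j`, which excludes finitely many `z`.
    intro c
    have hcont : Tendsto (fun z => Function.update c j z) (𝓝[≠] (c j)) (𝓝 c) := by
      have : Continuous fun z => Function.update c j z := continuous_const.update j continuous_id
      have h2 := this.tendsto (c j)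
      rw [Function.update_eq_self] at h2
      exact h2.mono_left nhdsWithin_le_nhds
    refine mem_closure_of_tendsto hcont ?_
    have hfin := Circle.finite_zpow_eq hj (∏ i ∈ Finset.univ.erase j, c i ^ v i)⁻¹
    have hev : ∀ᶠ z in 𝓝[≠] (c j),
        z ∉ {z : Circle | z ^ v j = (∏ i ∈ Finset.univ.erase j, c i ^ v i)⁻¹} := by
      -- `c j` may itself solve the relation; once it is removed, the finite set of solutions has a
      -- complement that is a neighbourhood of `c j`.
      have h1 := (hfin.subset (sdiff_subset (t := {c j}))).isClosed.isOpen_compl.mem_nhds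
        (x := c j) (by simp)
      filter_upwards [nhdsWithin_le_nhds h1, self_mem_nhdsWithin] with z hz hz' hmem
      exact hz ⟨hmem, hz'⟩
    filter_upwards [hev] with z hz hrel
    apply hz
    simp only [mem_ofPred_eq] at hrel ⊢
    rw [← Finset.mul_prod_erase _ _ (Finset.mem_univ j)] at hrel
    rw [eq_inv_iff_mul_eq_one, ← hrel]
    congr 1
    · simp
    · refine Finset.prod_congr rfl fun i hi => ?_
      rw [Function.update_of_ne (Finset.ne_of_mem_erase hi)]

/-! ### Convergence in `L⁰(μ, 𝕋)` -/

section L0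

variable {X : Type*} [MeasurableSpace X] {μ : Measure X}

theorem aestronglyMeasurable_coe (f : X →ₘ[μ] Circle) :
    AEStronglyMeasurable (fun x => (f x : ℂ)) μ :=
  continuous_subtype_val.comp_aestronglyMeasurable f.aestronglyMeasurable

variable [IsFiniteMeasure μ]

theorem dist_L0_def (f g : X →ₘ[μ] Circle) :
    dist f g = ∫ x, ‖(f x : ℂ) - (g x : ℂ)‖ ∂μ := rfl

/-- The limit is only complex-valued because the completeness proof does not yet know that it has
modulus one. -/
theorem exists_subseq_ae_tendsto_of_integral {u : ℕ → X →ₘ[μ] Circle} {w : X → ℂ}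
    (hw : Integrable w μ)
    (hu : Tendsto (fun n => ∫ x, ‖(u n x : ℂ) - w x‖ ∂μ) atTop (𝓝 0)) :
    ∃ ns : ℕ → ℕ, StrictMono ns ∧
      ∀ᵐ x ∂μ, Tendsto (fun n => (u (ns n) x : ℂ)) atTop (𝓝 (w x)) := by
  refine TendstoInMeasure.exists_seq_tendsto_ae (tendstoInMeasure_of_tendsto_eLpNorm one_ne_zero
    (fun n => aestronglyMeasurable_coe (u n)) hw.aestronglyMeasurable ?_)
  have hi : ∀ n, Integrable (fun x => (u n x : ℂ) - w x) μ := fun n =>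
    (Integrable.of_bound (aestronglyMeasurable_coe (u n)) 1
      (Eventually.of_forall fun x => (Circle.norm_coe _).le)).sub hw
  have : ∀ n, eLpNorm ((fun x => (u n x : ℂ)) - w) 1 μ
      = ENNReal.ofReal (∫ x, ‖(u n x : ℂ) - w x‖ ∂μ) := fun n => by
    rw [eLpNorm_one_eq_lintegral_enorm, ofReal_integral_norm_eq_lintegral_enorm (hi n)]
    rfl
  simp_rw [this]
  simpa using ENNReal.tendsto_ofReal hu

theorem exists_subseq_ae_tendsto {u : ℕ → X →ₘ[μ] Circle} {f : X →ₘ[μ] Circle}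
    (hu : Tendsto u atTop (𝓝 f)) : ∃ ns : ℕ → ℕ, StrictMono ns ∧
      ∀ᵐ x ∂μ, Tendsto (fun n => u (ns n) x) atTop (𝓝 (f x)) := by
  obtain ⟨ns, h1, h2⟩ := exists_subseq_ae_tendsto_of_integral (w := fun x => (f x : ℂ))
    (Integrable.of_bound (aestronglyMeasurable_coe f) 1
      (Eventually.of_forall fun x => (Circle.norm_coe _).le)) (tendsto_iff_dist_tendsto_zero.1 hu)
  refine ⟨ns, h1, ?_⟩
  filter_upwards [h2] with x hx
  exact tendsto_subtype_rng.2 hx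

/-- Completeness supplies the Baire property. An `L¹` limit is an almost everywhere limit along a
subsequence, hence has modulus one almost everywhere. -/
instance instCompleteSpaceL0 : CompleteSpace (X →ₘ[μ] Circle) := by
  refine Metric.complete_of_cauchySeq_tendsto fun u hu => ?_
  have hm : ∀ n, MemLp (fun x => (u n x : ℂ)) 1 μ := fun n =>
    memLp_one_iff_integrable.2 (Integrable.of_bound (aestronglyMeasurable_coe (u n)) 1
      (Eventually.of_forall fun x => (Circle.norm_coe _).le))
  have hdist : ∀ n m, dist ((hm n).toLp _) ((hm m).toLp _) = dist (u n) (u m) := fun n m => by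
    rw [dist_eq_norm, ← MemLp.toLp_sub, L1.norm_eq_integral_norm, dist_L0_def]
    refine integral_congr_ae ?_
    filter_upwards [MemLp.coeFn_toLp ((hm n).sub (hm m))] with x hx
    rw [hx]; rfl
  have hc : CauchySeq fun n => (hm n).toLp _ := by
    rw [Metric.cauchySeq_iff] at hu ⊢
    simpa only [hdist] using hu
  obtain ⟨w, hw⟩ := cauchySeq_tendsto_of_complete hc
  have hw' : Tendsto (fun n => ∫ x, ‖(u n x : ℂ) - w x‖ ∂μ) atTop (𝓝 0) := by
    refine (tendsto_iff_dist_tendsto_zero.1 hw).congr fun n => ?_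
    rw [dist_eq_norm, L1.norm_eq_integral_norm]
    refine integral_congr_ae ?_
    filter_upwards [MemLp.coeFn_toLp (hm n), Lp.coeFn_sub ((hm n).toLp _) w] with x h1 h2
    rw [h2, Pi.sub_apply, h1]
  obtain ⟨ns, -, hns⟩ := exists_subseq_ae_tendsto_of_integral (L1.integrable_coeFn w) hw'
  have hcirc : ∀ᵐ x ∂μ, ∃ z : Circle, (z : ℂ) = w x := by
    filter_upwards [hns] with x hx
    have h1 : ‖w x‖ = 1 := tendsto_nhds_unique hx.norm
      (by simp only [Circle.norm_coe]; exact tendsto_const_nhds)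
    exact ⟨⟨w x, mem_sphere_zero_iff_norm.2 h1⟩, rfl⟩
  classical
  let F : X → Circle := fun x => if h : ∃ z : Circle, (z : ℂ) = w x then h.choose else 1
  have hF : ∀ᵐ x ∂μ, (F x : ℂ) = w x := by
    filter_upwards [hcirc] with x hx
    simp only [F, dif_pos hx]
    exact hx.choose_spec
  have hFm : AEStronglyMeasurable F μ := by
    refine aestronglyMeasurable_of_tendsto_ae atTop (fun n => (u (ns n)).aestronglyMeasurable) ?_
    filter_upwards [hns, hF] with x hx hx'
    exact tendsto_subtype_rng.2 (by rw [← hx'] at hx; exact hx)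
  refine ⟨AEEqFun.mk F hFm, tendsto_iff_dist_tendsto_zero.2 (hw'.congr fun n => ?_)⟩
  rw [dist_L0_def]
  refine integral_congr_ae ?_
  filter_upwards [hF, AEEqFun.coeFn_mk F hFm] with x h1 h2
  rw [h2, h1]

end L0

/-! ### The functions `f^α` -/

/-- `f^α(x) = ∏ f(x_p)^{α(p)}`. -/
noncomputable def evalPow {X P : Type*} [Fintype P] (f : X → Circle) (α : P → ℤ)
    (x : P → X) : Circle :=
  ∏ p, f (x p) ^ α p

theorem measurable_evalPow {X P : Type*} [Fintype P] [MeasurableSpace X] {f : X → Circle}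
    (hf : Measurable f) (α : P → ℤ) : Measurable (evalPow f α) := by
  unfold evalPow
  exact Finset.measurable_fun_prod _ fun p _ =>
    (continuous_zpow (α p)).measurable.comp (hf.comp (measurable_pi_apply p))

theorem ae_forall_of_marginal {X P : Type*} [Countable P] [MeasurableSpace X] {μ : Measure X}
    {A : Measure (P → X)} (hA : ∀ p, A.map (fun x => x p) ≪ μ) {s : X → Prop}
    (hs : ∀ᵐ x ∂μ, s x) : ∀ᵐ x ∂A, ∀ p, s (x p) :=
  ae_all_iff.2 fun p => ae_of_ae_map (measurable_pi_apply p).aemeasurable ((hA p).ae_le hs)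

/-- Every subsequence has a further one converging `μ`-a.e.; absolutely continuous marginals turn
this into convergence at all coordinates `A`-a.e., and `g` is bounded on the compact circle. -/
theorem continuous_lintegral_evalPow {X P : Type*} [Fintype P] [MeasurableSpace X] {μ : Measure X}
    [IsFiniteMeasure μ] {A : Measure (P → X)} [IsFiniteMeasure A]
    (hA : ∀ p, A.map (fun x => x p) ≪ μ) (α : P → ℤ) (g : C(Circle, ℝ≥0)) :
    Continuous fun f : X →ₘ[μ] Circle => ∫⁻ x, g (evalPow f α x) ∂A := by
  refine continuous_iff_seqContinuous.2 fun u f hu => tendsto_of_subseq_tendsto fun ns hns => ?_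
  obtain ⟨ms, -, hms⟩ := exists_subseq_ae_tendsto (hu.comp hns)
  refine ⟨ms, ?_⟩
  obtain ⟨K, hK⟩ := (isCompact_range g.continuous).bddAbove
  refine tendsto_lintegral_of_dominated_convergence (fun _ => (K : ℝ≥0∞)) (fun n => ?_)
    (fun n => Eventually.of_forall fun x => ?_) (by simp [ENNReal.mul_eq_top]) ?_
  · exact (g.continuous.measurable.comp
      (measurable_evalPow (AEEqFun.measurable _) α)).coe_nnreal_ennreal
  · exact ENNReal.coe_le_coe.2 (hK (mem_range_self _))
  · filter_upwards [ae_forall_of_marginal hA hms] with x hx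
    refine ENNReal.tendsto_coe.2 ((g.continuous.tendsto _).comp ?_)
    exact tendsto_finsetProd _ fun p _ => ((continuous_zpow (α p)).tendsto _).comp (hx p)

/-! ### Approximation by sets depending on finitely many bits -/

section Bits

variable {X : Type*} [MeasurableSpace X] [MeasurableSpace.CountablyGenerated X]

/-- The first `n` binary digits of a point of a countably generated space. -/
noncomputable def bits (n : ℕ) (x : X) : Fin n → Bool :=
  fun i => MeasurableSpace.mapNatBool X x i

theorem measurable_bits (n : ℕ) : Measurable (bits n : X → Fin n → Bool) :=
  measurable_pi_lambda _ fun _ =>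
    (measurable_pi_apply _).comp (MeasurableSpace.measurable_mapNatBool X)

theorem bits_eq_of_le {m n : ℕ} (h : m ≤ n) {x y : X} (hxy : bits n x = bits n y) :
    bits m x = bits m y :=
  funext fun i => congrFun hxy (Fin.castLE h i)

theorem exists_bits_ne [MeasurableSpace.SeparatesPoints X] {x y : X} (h : x ≠ y) :
    ∃ n, bits n x ≠ bits n y := by
  obtain ⟨i, hi⟩ := Function.ne_iff.1 ((MeasurableSpace.injective_mapNatBool X).ne h)
  exact ⟨i + 1, fun h' => hi (congrFun h' (Fin.last i))⟩

/-- The sets in `X^P` that depend on finitely many bits of the coordinates. -/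
def cylinders (P X : Type*) [MeasurableSpace X] [MeasurableSpace.CountablyGenerated X] :
    Set (Set (P → X)) :=
  {E | ∃ n, ∀ x y : P → X, (∀ p, bits n (x p) = bits n (y p)) → x ∈ E → y ∈ E}

theorem measurableSet_of_bits {P : Type*} [Finite P] {n : ℕ} {E : Set (P → X)}
    (hE : ∀ x y : P → X, (∀ p, bits n (x p) = bits n (y p)) → x ∈ E → y ∈ E) :
    MeasurableSet E := by
  let F : (P → X) → (P → Fin n → Bool) := fun x p => bits n (x p)
  have hF : Measurable F :=
    measurable_pi_lambda _ fun p => (measurable_bits n).comp (measurable_pi_apply p)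
  have : E = F ⁻¹' (F '' E) := by
    refine Subset.antisymm (subset_preimage_image F E) ?_
    rintro y ⟨x, hx, hxy⟩
    exact hE x y (fun p => congrFun hxy p) hx
  rw [this]
  exact hF (toFinite _).measurableSet

theorem isSetAlgebra_cylinders (P : Type*) : IsSetAlgebra (cylinders P X) where
  empty_mem := ⟨0, fun _ _ _ h => h⟩
  compl_mem := by
    rintro s ⟨n, hn⟩
    exact ⟨n, fun x y hxy hx hy => hx (hn y x (fun p => (hxy p).symm) hy)⟩
  union_mem := by
    rintro s t ⟨n, hn⟩ ⟨m, hm⟩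
    refine ⟨max n m, fun x y hxy => Or.imp (hn x y fun p => ?_) (hm x y fun p => ?_)⟩
    · exact bits_eq_of_le (le_max_left _ _) (hxy p)
    · exact bits_eq_of_le (le_max_right _ _) (hxy p)

theorem generateFrom_cylinders (P : Type*) [Finite P] :
    (MeasurableSpace.pi : MeasurableSpace (P → X))
      = MeasurableSpace.generateFrom (cylinders P X) := by
  refine le_antisymm (iSup_le fun p => ?_) (MeasurableSpace.generateFrom_le ?_)
  · refine (MeasurableSpace.comap_mono
      (MeasurableSpace.generateFrom_natGeneratingSequence X).ge).trans ?_
    rw [MeasurableSpace.comap_generateFrom]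
    refine MeasurableSpace.generateFrom_mono ?_
    rintro _ ⟨_, ⟨i, rfl⟩, rfl⟩
    refine ⟨i + 1, fun x y hxy hx => ?_⟩
    have := congrFun (hxy p) (Fin.last i)
    simp only [bits, MeasurableSpace.mapNatBool, Fin.val_last, decide_eq_decide] at this
    exact this.1 hx
  · rintro E ⟨n, hE⟩
    exact measurableSet_of_bits hE

/-- Cylinders form an algebra generating the `σ`-algebra, so a separating set is approximated by one
of them for `A + B`, that is, for both measures at once. -/
theorem exists_cylinder_approx {P : Type*} [Finite P] {A B : Measure (P → X)} [IsFiniteMeasure A]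
    [IsFiniteMeasure B] (h : A ⟂ₘ B) {ε : ℝ≥0∞} (hε : 0 < ε) :
    ∃ E ∈ cylinders P X, A Eᶜ < ε ∧ B E < ε := by
  obtain ⟨s, hs, hA, hB⟩ := h
  obtain ⟨δ, hδ, hδε⟩ := ENNReal.lt_iff_exists_nnreal_btwn.1 hε
  obtain ⟨E, hE, hlt⟩ := (Measure.MeasureDense.of_generateFrom_isSetAlgebra_finite (A + B)
    (isSetAlgebra_cylinders P) (generateFrom_cylinders P)).approx sᶜ hs.compl
    (measure_ne_top _ _) δ (by exact_mod_cast hδ)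
  rw [ENNReal.ofReal_coe_nnreal] at hlt
  have hlt' := hlt.trans hδε
  rw [Measure.add_apply] at hlt'
  refine ⟨E, hE, ?_, ?_⟩
  · calc A Eᶜ ≤ A (symmDiff sᶜ E ∪ s) := measure_mono fun x hx => by
          by_cases hxs : x ∈ s
          · exact Or.inr hxs
          · exact Or.inl (Or.inl ⟨hxs, hx⟩)
      _ ≤ A (symmDiff sᶜ E) + A s := measure_union_le _ _
      _ ≤ A (symmDiff sᶜ E) + B (symmDiff sᶜ E) := by rw [hA]; gcongr; simp
      _ < ε := hlt'
  · calc B E ≤ B (symmDiff sᶜ E ∪ sᶜ) := measure_mono fun x hx => by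
          by_cases hxs : x ∈ sᶜ
          · exact Or.inr hxs
          · exact Or.inl (Or.inr ⟨hx, hxs⟩)
      _ ≤ B (symmDiff sᶜ E) + B sᶜ := measure_union_le _ _
      _ ≤ A (symmDiff sᶜ E) + B (symmDiff sᶜ E) := by
          rw [hB, add_zero]; exact le_add_self
      _ < ε := hlt'

/-- The sets decrease with `n`, and since bits separate points, their intersection lies in the union
of the null diagonals. -/
theorem tendsto_measure_not_injective_bits [MeasurableSpace.SeparatesPoints X] {P : Type*}
    [Fintype P] (A : Measure (P → X)) [IsFiniteMeasure A]
    (hA : ∀ a b : P, a ≠ b → A {x | x a = x b} = 0) :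
    Tendsto (fun n => A {x | ¬ Function.Injective fun p => bits n (x p)}) atTop (𝓝 0) := by
  classical
  have h := tendsto_measure_iInter_atTop (μ := A)
    (s := fun n => {x : P → X | ¬ Function.Injective fun p => bits n (x p)})
    (fun n => (measurableSet_of_bits (n := n) fun x y hxy hx => by
      simpa only [mem_ofPred_eq, hxy] using hx).nullMeasurableSet)
    (fun m n hmn x hx hinj => hx fun p p' hp => hinj (bits_eq_of_le hmn hp))
    ⟨0, measure_ne_top _ _⟩
  have h0 : A (⋂ n, {x : P → X | ¬ Function.Injective fun p => bits n (x p)}) = 0 := by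
    refine measure_mono_null (t := ⋃ q : {q : P × P // q.1 ≠ q.2}, {x | x q.1.1 = x q.1.2}) ?_
      (measure_iUnion_null fun q => hA _ _ q.2)
    intro x hx
    by_contra hne
    simp only [mem_iUnion, mem_ofPred_eq, not_exists] at hne
    choose N hN using fun q => exists_bits_ne (hne q)
    refine mem_iInter.1 hx (Finset.univ.sup N) fun a b hab => ?_
    by_contra hq
    exact hN ⟨(a, b), hq⟩
      (bits_eq_of_le (Finset.le_sup (f := N) (Finset.mem_univ ⟨(a, b), hq⟩)) hab)
  rw [h0] at h
  exact h

end Bits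

/-! ### Coincidences between monomials in independent points -/

theorem prod_comp_zpow_eq {P C : Type*} [Fintype P] [Fintype C] [DecidableEq C] (c : C → Circle)
    (J : P → C) (α : P → ℤ) :
    ∏ p, c (J p) ^ α p = ∏ j, c j ^ (∑ p, if J p = j then α p else 0) := by
  have h : ∀ j, c j ^ (∑ p, if J p = j then α p else 0)
      = ∏ p, if J p = j then c j ^ α p else 1 := fun j => by
    have hs : ∀ (s : Finset P) (k : P → ℤ), c j ^ (∑ p ∈ s, k p) = ∏ p ∈ s, c j ^ k p := by
      intro s k
      induction s using Finset.cons_induction with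
      | empty => simp
      | cons a s ha ih => rw [Finset.sum_cons, Finset.prod_cons, zpow_add, ih]
    rw [hs]
    exact Finset.prod_congr rfl fun p _ => by split_ifs <;> simp
  simp_rw [h]
  rw [Finset.prod_comm]
  exact Finset.prod_congr rfl fun p _ => by simp

/-- Independence equates the total exponents of each `c j` on the two sides. By injectivity such a
total is a single exponent or zero, and since the exponents are non-zero, both sides use the same
points. -/
theorem exists_equiv_of_prod_eq {P Q C : Type*} [Fintype P] [Fintype Q] [Fintype C]
    {c : C → Circle} (hc : ∀ v : C → ℤ, ∏ j, c j ^ v j = 1 → v = 0) {J : P → C} {J' : Q → C}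
    (hJ : Function.Injective J) (hJ' : Function.Injective J') {α : P → ℤ} {β : Q → ℤ}
    (hα : ∀ p, α p ≠ 0) (hβ : ∀ q, β q ≠ 0)
    (h : ∏ p, c (J p) ^ α p = ∏ q, c (J' q) ^ β q) :
    ∃ r : P ≃ Q, (∀ p, J' (r p) = J p) ∧ ∀ p, α p = β (r p) := by
  classical
  rw [prod_comp_zpow_eq c J, prod_comp_zpow_eq c J'] at h
  have hv := hc (fun j => (∑ p, if J p = j then α p else 0) - ∑ q, if J' q = j then β q else 0) (by
    simp only [zpow_sub, Finset.prod_mul_distrib, h, Finset.prod_inv_distrib, mul_inv_cancel])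
  have hv' : ∀ j, (∑ p, if J p = j then α p else 0) = ∑ q, if J' q = j then β q else 0 :=
    fun j => sub_eq_zero.1 (congrFun hv j)
  have hleft : ∀ p, (∑ p', if J p' = J p then α p' else 0) = α p := fun p => by
    simp [hJ.eq_iff]
  have hright : ∀ q, (∑ q', if J' q' = J' q then β q' else 0) = β q := fun q => by
    simp [hJ'.eq_iff]
  have hr : ∀ p, ∃ q, J' q = J p := fun p => by
    by_contra! hne
    have := hv' (J p)
    rw [hleft, Finset.sum_eq_zero fun q _ => if_neg (hne q)] at this
    exact hα p this
  have hr' : ∀ q, ∃ p, J p = J' q := fun q => by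
    by_contra! hne
    have := hv' (J' q)
    rw [hright, Finset.sum_eq_zero fun p _ => if_neg (hne p)] at this
    exact hβ q this.symm
  choose r hr using hr
  choose r' hr' using hr'
  refine ⟨⟨r, r', fun p => hJ (by rw [hr', hr]), fun q => hJ' (by rw [hr, hr'])⟩, hr, fun p => ?_⟩
  have := hv' (J p)
  rw [hleft, ← hr p, hright] at this
  exact this

/-! ### Generic singularity of the images of two measures -/

theorem exists_finite_approx {X : Type*} [MeasurableSpace X] {f : X → Circle} (hf : Measurable f)
    {δ : ℝ} (hδ : 0 < δ) : ∃ (t : Finset Circle) (m : X → t),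
      Measurable m ∧ ∀ x, dist (m x : Circle) (f x) < δ := by
  obtain ⟨t, ht⟩ := isCompact_univ.elim_finite_subcover
    (fun n => Metric.ball (TopologicalSpace.denseSeq Circle n) δ) (fun _ => Metric.isOpen_ball)
    (fun z _ => by
      obtain ⟨n, hn⟩ := (TopologicalSpace.denseRange_denseSeq Circle).exists_dist_lt z hδ
      exact mem_iUnion.2 ⟨n, hn⟩)
  let s := SimpleFunc.nearestPt (TopologicalSpace.denseSeq Circle) (t.sup id)
  refine ⟨s.range, fun x => ⟨s (f x), s.mem_range_self _⟩,
    (s.measurable.comp hf).subtype_mk, fun x => ?_⟩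
  obtain ⟨n, hn, hx⟩ := mem_iUnion₂.1 (ht (mem_univ (f x)))
  rw [← ENNReal.ofReal_lt_ofReal_iff hδ, ← edist_dist]
  refine (SimpleFunc.edist_nearestPt_le _ _ (Finset.le_sup (f := id) hn)).trans_lt ?_
  rw [edist_dist, ENNReal.ofReal_lt_ofReal_iff hδ, dist_comm]
  exact hx

theorem finite_range_evalPow {X P C : Type*} [Fintype P] [Finite C] (c : C → Circle) (q : X → C)
    (γ : P → ℤ) : (range (evalPow (fun x => c (q x)) γ)).Finite :=
  (finite_range fun J : P → C => ∏ p, c (J p) ^ γ p).subset (by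
    rintro _ ⟨x, rfl⟩
    exact ⟨fun p => q (x p), rfl⟩)

theorem dense_separating {X : Type*} [MeasurableSpace X] [StandardBorelSpace X] {μ : Measure X}
    [IsProbabilityMeasure μ] {P Q : Type*} [Fintype P] [Fintype Q] {α : P → ℤ} {β : Q → ℤ}
    (hα : ∀ p, α p ≠ 0) (hβ : ∀ q, β q ≠ 0) {A : Measure (P → X)} {B : Measure (Q → X)}
    [IsFiniteMeasure A] [IsFiniteMeasure B] (hA : ∀ p, A.map (fun x => x p) ≪ μ)
    (hB : ∀ q, B.map (fun x => x q) ≪ μ) (hA' : ∀ a b, a ≠ b → A {x | x a = x b} = 0)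
    (hB' : ∀ a b, a ≠ b → B {x | x a = x b} = 0)
    (hr : ∀ r : P ≃ Q, (∀ p, α p = β (r p)) → A ⟂ₘ B.map fun x p => x (r p))
    {ε : ℝ≥0∞} (hε : 0 < ε) :
    Dense {f : X →ₘ[μ] Circle | ∃ g h : C(Circle, ℝ≥0), g + h = 1 ∧
      ∫⁻ x, g (evalPow f α x) ∂A < ε ∧ ∫⁻ x, h (evalPow f β x) ∂B < ε} := by
  classical
  intro f₀
  refine Metric.mem_closure_iff.2 fun δ hδ => ?_
  have hε2 : 0 < ε / 2 := ENNReal.half_pos hε.ne'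
  let R := {r : P ≃ Q // ∀ p, α p = β (r p)}
  -- Summing over the finitely many admissible matchings lets one cylinder `E` serve all of them.
  let B' : Measure (P → X) := Measure.sum fun r : R => B.map fun x p => x (r.1 p)
  have hmeas : ∀ r : P ≃ Q, Measurable fun (x : Q → X) p => x (r p) := fun r =>
    measurable_pi_lambda _ fun p => measurable_pi_apply _
  obtain ⟨E, ⟨n₀, hE⟩, hAE, hBE⟩ := exists_cylinder_approx (B := B')
    (Measure.MutuallySingular.sum_right.2 fun r : R => hr r.1 r.2) hε2
  obtain ⟨n, hn₀, hnA, hnB⟩ := ((eventually_ge_atTop n₀).and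
    (((tendsto_measure_not_injective_bits A hA').eventually_lt_const hε2).and
    ((tendsto_measure_not_injective_bits B hB').eventually_lt_const hε2))).exists
  have hEmeas : MeasurableSet E := measurableSet_of_bits hE
  obtain ⟨t, m, hm, hmf⟩ := exists_finite_approx (AEEqFun.measurable f₀) (δ := δ / 4)
    (by positivity)
  -- A cell records the bits and the approximate value of `f₀`; its new value `c j` is a small
  -- perturbation of the latter, chosen independent of the others.
  obtain ⟨c, hc, hcd⟩ := (dense_multiplicativelyIndependent ((Fin n → Bool) × t)).exists_dist_lt
    (fun j => (j.2 : Circle)) (ε := δ / 4) (by positivity)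
  let q : X → (Fin n → Bool) × t := fun x => (bits n x, m x)
  have hq : Measurable q := (measurable_bits n).prodMk hm
  have hF : Measurable fun x => c (q x) := (measurable_of_finite c).comp hq
  let f : X →ₘ[μ] Circle := AEEqFun.mk (fun x => c (q x)) hF.aestronglyMeasurable
  have hf : ∀ᵐ x ∂μ, f x = c (q x) := AEEqFun.coeFn_mk _ _
  let good : Set (P → X) := {x | x ∈ E ∧ Function.Injective fun p => bits n (x p)}
  let bad : Set (Q → X) := {y | ¬ Function.Injective fun p => bits n (y p)} ∪
    ⋃ r : R, (fun (x : Q → X) p => x (r.1 p)) ⁻¹' E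
  have hgood : A goodᶜ < ε := by
    calc A goodᶜ ≤ A (Eᶜ ∪ {x | ¬ Function.Injective fun p => bits n (x p)}) :=
          measure_mono fun x hx => not_and_or.1 hx
      _ ≤ A Eᶜ + A {x | ¬ Function.Injective fun p => bits n (x p)} := measure_union_le _ _
      _ < ε / 2 + ε / 2 := ENNReal.add_lt_add hAE hnA
      _ = ε := ENNReal.add_halves ε
  have hbad : B bad < ε := by
    calc B bad ≤ B {x | ¬ Function.Injective fun p => bits n (x p)} +
          B (⋃ r : R, (fun (x : Q → X) p => x (r.1 p)) ⁻¹' E) := measure_union_le _ _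
      _ ≤ B {x | ¬ Function.Injective fun p => bits n (x p)} + B' E := by
          gcongr
          rw [Measure.sum_apply _ hEmeas]
          refine (measure_iUnion_le _).trans (ENNReal.tsum_le_tsum fun r => ?_)
          rw [Measure.map_apply (hmeas _) hEmeas]
      _ < ε / 2 + ε / 2 := ENNReal.add_lt_add hnB hBE
      _ = ε := ENNReal.add_halves ε
  let S := evalPow (fun x => c (q x)) α '' good
  have hS : S.Finite := (finite_range_evalPow c q α).subset (image_subset_range _ _)
  have hsep : ∀ y ∉ bad, evalPow (fun x => c (q x)) β y ∉ S := by
    rintro y hy ⟨x, ⟨hxE, hxi⟩, hxy⟩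
    have hyi : Function.Injective fun p => bits n (y p) := by
      by_contra h
      exact hy (Or.inl h)
    -- A coincidence of values yields a matching of cells; as `E` sees only `n₀ ≤ n` bits, the
    -- rearranged `y` would lie in `E`.
    obtain ⟨r, hr1, hr2⟩ := exists_equiv_of_prod_eq hc
      (fun a b h => hxi (congrArg Prod.fst h) : Function.Injective fun p => q (x p))
      (fun a b h => hyi (congrArg Prod.fst h) : Function.Injective fun p => q (y p)) hα hβ hxy
    refine hy (Or.inr (mem_iUnion.2 ⟨⟨r, hr2⟩, hE x _ (fun p => ?_) hxE⟩))
    exact bits_eq_of_le hn₀ (congrArg Prod.fst (hr1 p)).symm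
  -- The step function gives finitely many values, so both sets are finite, hence closed, and
  -- Urysohn's lemma provides the test function.
  obtain ⟨φ, hφ0, hφ1, hφ⟩ := exists_continuous_zero_one_of_isClosed (X := Circle) hS.isClosed
    (t := range (evalPow (fun x => c (q x)) β) \ S)
    ((finite_range_evalPow c q β).subset sdiff_subset).isClosed
    disjoint_sdiff_right
  refine ⟨f, ⟨⟨fun z => (φ z).toNNReal, by fun_prop⟩, ⟨fun z => (1 - φ z).toNNReal, by fun_prop⟩,
    ?_, ?_, ?_⟩, ?_⟩
  · ext z
    simp [Real.coe_toNNReal _ (hφ z).1, Real.coe_toNNReal _ (sub_nonneg.2 (hφ z).2)]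
  · refine lt_of_le_of_lt ?_ hgood
    refine le_trans ?_ (lintegral_indicator_one_le _)
    refine lintegral_mono_ae ?_
    filter_upwards [ae_forall_of_marginal hA hf] with x hx
    have hev : evalPow f α x = evalPow (fun x => c (q x)) α x :=
      Finset.prod_congr rfl fun p _ => by rw [hx]
    rw [hev]
    by_cases hxg : x ∈ good
    · simp [hφ0 (mem_image_of_mem _ hxg)]
    · rw [indicator_of_mem (by exact hxg)]
      simpa using (hφ _).2
  · refine lt_of_le_of_lt ?_ hbad
    refine le_trans ?_ (lintegral_indicator_one_le _)
    refine lintegral_mono_ae ?_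
    filter_upwards [ae_forall_of_marginal hB hf] with x hx
    have hev : evalPow f β x = evalPow (fun x => c (q x)) β x :=
      Finset.prod_congr rfl fun p _ => by rw [hx]
    rw [hev]
    by_cases hxg : x ∈ bad
    · rw [indicator_of_mem hxg]
      simpa using (hφ _).1
    · simp [hφ1 ⟨mem_range_self _, hsep x hxg⟩]
  · rw [dist_L0_def]
    have hle : ∫ x, ‖(f₀ x : ℂ) - (f x : ℂ)‖ ∂μ ≤ ∫ _, δ / 2 ∂μ := by
      refine integral_mono_ae (integrable_norm_sub f₀ f) (integrable_const _) ?_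
      filter_upwards [hf] with x hx
      have h1 : dist (f x) (m x : Circle) < δ / 4 := by
        rw [hx, dist_comm]
        exact (dist_le_pi_dist (fun j : (Fin n → Bool) × t => (j.2 : Circle)) c (q x)).trans_lt hcd
      have h2 := dist_triangle (f x) (m x : Circle) (f₀ x)
      have h3 := hmf x
      have h4 : ‖(f₀ x : ℂ) - (f x : ℂ)‖ = dist (f x) (f₀ x) := by
        rw [dist_comm]; exact (dist_eq_norm (f₀ x : ℂ) (f x : ℂ)).symm
      linarith
    have : ∫ _, δ / 2 ∂μ = δ / 2 := by simp
    linarith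

theorem eventually_residual_mutuallySingular {X : Type*} [MeasurableSpace X]
    [StandardBorelSpace X] {μ : Measure X} [IsProbabilityMeasure μ] {P Q : Type*} [Fintype P]
    [Fintype Q] {α : P → ℤ} {β : Q → ℤ} (hα : ∀ p, α p ≠ 0) (hβ : ∀ q, β q ≠ 0)
    {A : Measure (P → X)} {B : Measure (Q → X)} [IsFiniteMeasure A] [IsFiniteMeasure B]
    (hA : ∀ p, A.map (fun x => x p) ≪ μ) (hB : ∀ q, B.map (fun x => x q) ≪ μ)
    (hA' : ∀ a b, a ≠ b → A {x | x a = x b} = 0) (hB' : ∀ a b, a ≠ b → B {x | x a = x b} = 0)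
    (hr : ∀ r : P ≃ Q, (∀ p, α p = β (r p)) → A ⟂ₘ B.map fun x p => x (r p)) :
    ∀ᶠ f : X →ₘ[μ] Circle in residual (X →ₘ[μ] Circle),
      (A.map (evalPow f α)) ⟂ₘ (B.map (evalPow f β)) := by
  have hε : ∀ n : ℕ, (0 : ℝ≥0∞) < (n + 1 : ℝ≥0∞)⁻¹ := fun n => by
    simp [ENNReal.inv_pos]
  have key : ∀ n : ℕ, ∀ᶠ f : X →ₘ[μ] Circle in residual (X →ₘ[μ] Circle),
      ∃ g h : C(Circle, ℝ≥0), g + h = 1 ∧ ∫⁻ x, g (evalPow f α x) ∂A < (n + 1 : ℝ≥0∞)⁻¹ ∧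
        ∫⁻ x, h (evalPow f β x) ∂B < (n + 1 : ℝ≥0∞)⁻¹ := fun n => by
    refine residual_of_dense_open ?_ (dense_separating hα hβ hA hB hA' hB' hr (hε n))
    simp only [ofPred_exists, ofPred_and]
    refine isOpen_iUnion fun g => isOpen_iUnion fun h => isOpen_const.inter (IsOpen.inter ?_ ?_)
    · exact isOpen_lt (continuous_lintegral_evalPow hA α g) continuous_const
    · exact isOpen_lt (continuous_lintegral_evalPow hB β h) continuous_const
  filter_upwards [eventually_countable_forall.2 key] with f hf
  refine mutuallySingular_of_forall_continuous fun ε hε => ?_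
  obtain ⟨n, hn⟩ := ENNReal.exists_inv_nat_lt hε.ne'
  have hn' : (n + 1 : ℝ≥0∞)⁻¹ < ε :=
    (ENNReal.inv_le_inv.2 (le_self_add : (n : ℝ≥0∞) ≤ n + 1)).trans_lt hn
  obtain ⟨g, h, hgh, hg, hh⟩ := hf n
  refine ⟨g, h, hgh, ?_, ?_⟩
  · rw [lintegral_map g.continuous.measurable.coe_nnreal_ennreal
      (measurable_evalPow (AEEqFun.measurable f) α)]
    exact hg.trans hn'
  · rw [lintegral_map h.continuous.measurable.coe_nnreal_ennreal
      (measurable_evalPow (AEEqFun.measurable f) β)]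
    exact hh.trans hn'

/-! ### The product measures -/

section ProdMeasure

variable {X : Type*} [MeasurableSpace X] {μ : Measure X}
  {lam : (κ : Weight) → ℕ+ → Measure (Fin κ.len → X)}

theorem measurable_uncurry_concat {l : ℕ} (κ : Fin l → Weight) :
    Measurable fun (y : ∀ i, Fin (κ i).len → X) (p : ConcatIndex κ) => y p.1 p.2 :=
  measurable_pi_lambda _ fun p => (measurable_pi_apply p.2).comp (measurable_pi_apply p.1)

theorem isFiniteMeasure_prodMeasure (hlam : IsSoleckiFamily μ lam) {l : ℕ} (κ : Fin l → Weight) :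
    IsFiniteMeasure (prodMeasure lam κ) := by
  have := hlam.finite
  unfold prodMeasure
  infer_instance

theorem prodMeasure_marginal (hlam : IsSoleckiFamily μ lam) {l : ℕ} (κ : Fin l → Weight)
    (p : ConcatIndex κ) : (prodMeasure lam κ).map (fun x => x p) ≪ μ := by
  have := hlam.finite
  refine Measure.AbsolutelyContinuous.mk fun s hs h0 => ?_
  rw [Measure.map_apply (measurable_pi_apply p) hs, prodMeasure,
    Measure.map_apply (measurable_uncurry_concat κ) (measurable_pi_apply p hs)]
  have h1 := hlam.marginal (κ p.1) 1 p.2 h0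
  rw [Measure.map_apply (measurable_pi_apply _) hs] at h1
  exact Measure.pi_eval_preimage_null (fun i => lam (κ i) 1) h1

/-- Fubini: with the other blocks fixed, the slice is `{x | x a = z}`, which is null. This handles
coincidences between different blocks. -/
theorem measure_pi_coincidence_eq_zero [MeasurableEq X] {l : ℕ} {n : Fin l → ℕ}
    (τ : ∀ i, Measure (Fin (n i) → X)) [∀ i, IsFiniteMeasure (τ i)]
    {i j : Fin l} (hij : i ≠ j) (a : Fin (n i)) (b : Fin (n j))
    (h0 : ∀ z : X, τ i {x | x a = z} = 0) :
    Measure.pi τ {y | y i a = y j b} = 0 := by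
  obtain _ | l := l
  · exact i.elim0
  obtain ⟨j', rfl⟩ := Fin.exists_succAbove_eq hij.symm
  have hmp := measurePreserving_piFinSuccAbove τ i
  have hms : MeasurableSet
      {w : (Fin (n i) → X) × (∀ j, Fin (n (i.succAbove j)) → X) | w.1 a = w.2 j' b} :=
    measurableSet_eq_fun ((measurable_pi_apply a).comp measurable_fst)
      ((measurable_pi_apply b).comp ((measurable_pi_apply j').comp measurable_snd))
  refine (hmp.measure_preimage hms.nullMeasurableSet).trans ?_
  rw [Measure.prod_apply_symm hms]
  simp [h0]

theorem prodMeasure_diagonal [StandardBorelSpace X] [NullSingletonClass μ]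
    (hlam : IsSoleckiFamily μ lam) {l : ℕ} (κ : Fin l → Weight) (p p' : ConcatIndex κ)
    (h : p ≠ p') : prodMeasure lam κ {x | x p = x p'} = 0 := by
  have := hlam.finite
  have hms : MeasurableSet {x : ConcatIndex κ → X | x p = x p'} :=
    measurableSet_eq_fun (measurable_pi_apply p) (measurable_pi_apply p')
  rw [prodMeasure, Measure.map_apply (measurable_uncurry_concat κ) hms]
  obtain ⟨i, a⟩ := p
  obtain ⟨j, b⟩ := p'
  by_cases hij : i = j
  · subst hij
    have hab : a ≠ b := fun hab => h (by rw [hab])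
    have h1 : lam (κ i) 1 {x | x a = x b} = 0 := by
      rcases lt_or_gt_of_ne hab with hlt | hlt
      · exact hlam.diagonal _ _ _ _ hlt
      · simpa only [eq_comm] using hlam.diagonal (κ i) 1 _ _ hlt
    exact Measure.pi_eval_preimage_null (fun i => lam (κ i) 1) h1
  · refine measure_pi_coincidence_eq_zero (fun i => lam (κ i) 1) hij a b fun z => ?_
    have h1 := hlam.marginal (κ i) 1 a (measure_singleton z)
    rwa [Measure.map_apply (measurable_pi_apply _) (measurableSet_singleton z)] at h1

end ProdMeasure

/-! ### The measure `|h|² dρ` of a square integrable function -/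

section NormSq

variable {Y : Type*} [MeasurableSpace Y] {ρ : Measure Y}

/-- The measure with density `|h|²` with respect to `ρ`. -/
noncomputable def normSqMeasure (h : Lp ℂ 2 ρ) : Measure Y :=
  ρ.withDensity fun y => ((‖h y‖₊ ^ 2 : ℝ≥0) : ℝ≥0∞)

theorem measurable_nnnorm_sq (h : Lp ℂ 2 ρ) : Measurable fun y => ‖h y‖₊ ^ 2 :=
  (Lp.stronglyMeasurable h).measurable.nnnorm.pow_const 2

theorem normSqMeasure_univ (h : Lp ℂ 2 ρ) :
    normSqMeasure h univ = ENNReal.ofReal (‖h‖ ^ 2) := by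
  have h1 := eLpNorm_nnreal_pow_eq_lintegral (f := h) (μ := ρ) (p := 2) two_ne_zero
  rw [normSqMeasure, withDensity_apply _ MeasurableSet.univ, Measure.restrict_univ, Lp.norm_def,
    ← ENNReal.toReal_pow, ENNReal.ofReal_toReal (ENNReal.pow_ne_top (Lp.eLpNorm_ne_top h))]
  simpa [enorm_eq_nnnorm] using h1.symm

theorem normSqMeasure_absolutelyContinuous (h : Lp ℂ 2 ρ) : normSqMeasure h ≪ ρ :=
  withDensity_absolutelyContinuous _ _

theorem absolutelyContinuous_normSqMeasure {h : Lp ℂ 2 ρ} (hh : ∀ᵐ y ∂ρ, h y ≠ 0) :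
    ρ ≪ normSqMeasure h := by
  refine withDensity_absolutelyContinuous'
    (measurable_nnnorm_sq h).coe_nnreal_ennreal.aemeasurable ?_
  filter_upwards [hh] with y hy
  simpa using hy

theorem integral_normSqMeasure (h : Lp ℂ 2 ρ) (φ : Y → ℂ) :
    ∫ y, φ y ∂normSqMeasure h = ∫ y, φ y * (starRingEnd ℂ (h y) * h y) ∂ρ := by
  rw [normSqMeasure, integral_withDensity_eq_integral_smul (measurable_nnnorm_sq h)]
  refine integral_congr_ae (Eventually.of_forall fun y => ?_)
  simp only [NNReal.smul_def, Complex.real_smul, Complex.conj_mul']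
  push_cast
  simp [mul_comm]

end NormSq

/-! ### Uniqueness of spectral measures -/

theorem IsSpectralMeasure.unique {H : Type*} [NormedAddCommGroup H] [InnerProductSpace ℂ H]
    [CompleteSpace H] {u : unitary (H →L[ℂ] H)} {h : H} {a b : Measure Circle}
    (ha : IsSpectralMeasure u h a) (hb : IsSpectralMeasure u h b) : a = b := by
  have := ha.1
  have := hb.1
  exact measure_circle_ext fun n => (ha.2 n).symm.trans (hb.2 n)

instance Weight.instCountable : Countable Weight := by
  refine Function.Injective.countable
    (f := fun κ : Weight => (⟨κ.len, κ.entry⟩ : Σ n, Fin n → ℤ)) ?_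
  rintro ⟨n, h1, e, h2, h3⟩ ⟨n', h1', e', h2', h3'⟩ h
  obtain ⟨rfl, h⟩ := Sigma.mk.inj h
  obtain rfl := eq_of_heq h
  rfl

/-! ### Spectral measures of a direct sum of multiplication representations -/

section Spectral

theorem evalPow_zpow {X P : Type*} [Fintype P] (f : X → Circle) (α : P → ℤ) (x : P → X) (k : ℤ) :
    evalPow (fun y => f y ^ k) α x = evalPow f α x ^ k := by
  simp only [evalPow, ← Finset.prod_zpow, ← zpow_mul, mul_comm k]

variable {X : Type*} [MeasurableSpace X] {μ : Measure X}
  {lam : (κ : Weight) → ℕ+ → Measure (Fin κ.len → X)}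

theorem measurable_evalPow_zpow {P : Type*} [Fintype P] (f : X →ₘ[μ] Circle) (α : P → ℤ) (k : ℤ) :
    Measurable fun x => evalPow f α x ^ k :=
  (continuous_zpow k).measurable.comp (measurable_evalPow (AEEqFun.measurable f) α)

/-- The image of `λ_κ^1` under `f^{kκ}`. -/
noncomputable def weightMeasure (lam : (κ : Weight) → ℕ+ → Measure (Fin κ.len → X))
    (f : X →ₘ[μ] Circle) (k : ℤ) (κ : Weight) : Measure Circle :=
  (lam κ 1).map fun x => evalPow f κ.entry x ^ k

/-- The spectral measure for `Φ(f)^k` of the vector with components `w`. -/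
noncomputable def vectorMeasure (w : ∀ p : Weight × ℕ+, Lp ℂ 2 (lam p.1 p.2))
    (f : X →ₘ[μ] Circle) (k : ℤ) : Measure Circle :=
  Measure.sum fun p : Weight × ℕ+ =>
    (normSqMeasure (w p)).map fun x => evalPow f p.1.entry x ^ k

theorem isFiniteMeasure_vectorMeasure
    (w : lp (fun p : Weight × ℕ+ => Lp ℂ 2 (lam p.1 p.2)) 2) (f : X →ₘ[μ] Circle) (k : ℤ) :
    IsFiniteMeasure (vectorMeasure (fun p => w p) f k) := by
  refine ⟨?_⟩
  rw [vectorMeasure, Measure.sum_apply _ MeasurableSet.univ]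
  have h : ∀ p : Weight × ℕ+, (normSqMeasure (w p)).map (fun x => evalPow f p.1.entry x ^ k) univ
      = ENNReal.ofReal (‖w p‖ ^ 2) := fun p => by
    rw [Measure.map_apply (measurable_evalPow_zpow f _ k) MeasurableSet.univ, preimage_univ,
      normSqMeasure_univ]
  simp_rw [h]
  have hs : Summable fun p => ‖w p‖ ^ 2 := by
    simpa using (lp.memℓp w).summable (by norm_num)
  exact hs.tsum_ofReal_lt_top

variable {H : Type*} [NormedAddCommGroup H] [InnerProductSpace ℂ H] [CompleteSpace H]
  {Φ : (X →ₘ[μ] Circle) →* unitary (H →L[ℂ] H)}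

/-- `U` carries `Φ(f)` to multiplication by `f^κ` in the summand indexed by `(κ, i)`. -/
def Intertwines (U : H ≃ₗᵢ[ℂ] lp (fun p : Weight × ℕ+ => Lp ℂ 2 (lam p.1 p.2)) 2)
    (Φ : (X →ₘ[μ] Circle) →* unitary (H →L[ℂ] H)) : Prop :=
  ∀ (f : X →ₘ[μ] Circle) (v : H) (κ : Weight) (i : ℕ+),
    ⇑(U ((Φ f : H →L[ℂ] H) v) (κ, i)) =ᵐ[lam κ i]
      fun x => powWeight f κ x * (U v (κ, i) : (Fin κ.len → X) → ℂ) x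

variable {U : H ≃ₗᵢ[ℂ] lp (fun p : Weight × ℕ+ => Lp ℂ 2 (lam p.1 p.2)) 2}

theorem isSpectralMeasure_vectorMeasure (hlam : IsSoleckiFamily μ lam) (hU : Intertwines U Φ)
    (f : X →ₘ[μ] Circle) (k : ℤ) (v : H) :
    IsSpectralMeasure (Φ f ^ k) v (vectorMeasure (fun p => U v p) f k) := by
  have hfin := isFiniteMeasure_vectorMeasure (U v) f k
  refine ⟨hfin, fun n => ?_⟩
  have hmon : ⇑(circleMonomial n) = fun z : Circle => (z : ℂ) ^ n :=
    funext (circleMonomial_apply n)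
  have hint : Integrable (fun z : Circle => (z : ℂ) ^ n) (vectorMeasure (fun p => U v p) f k) := by
    rw [← hmon]; exact (circleMonomial n).integrable _
  have h1 := hasSum_integral_measure hint
  rw [← U.inner_map_map]
  refine (lp.hasSum_inner _ _).unique (h1.congr_fun fun p => ?_)
  rw [integral_map (measurable_evalPow_zpow f _ k).aemeasurable (by
      rw [← hmon]; exact (circleMonomial n).continuous.aestronglyMeasurable),
    integral_normSqMeasure, L2.inner_def]
  refine integral_congr_ae ?_
  -- Apply the intertwining relation once, at the group element `f ^ (k * n)`, instead of iterating
  -- it.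
  have hpow : (Φ f ^ k) ^ n = Φ (f ^ (k * n)) := by rw [map_zpow, zpow_mul]
  rw [hpow]
  obtain ⟨κ, i⟩ := p
  filter_upwards [hU (f ^ (k * n)) v κ i,
    ae_forall_of_marginal (hlam.marginal κ i) (AEEqFun.coeFn_zpow f (k * n))] with x hx hx'
  have h2 : powWeight (f ^ (k * n)) κ x = ((evalPow f κ.entry x ^ k : Circle) : ℂ) ^ n := by
    rw [← Circle.coe_zpow, ← zpow_mul, ← evalPow_zpow]
    exact congrArg Subtype.val (Finset.prod_congr rfl fun j _ => by rw [hx' j]; rfl)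
  rw [hx, h2, RCLike.inner_apply]
  ring

theorem exists_cyclic (hlam : IsSoleckiFamily μ lam) :
    ∃ w : lp (fun p : Weight × ℕ+ => Lp ℂ 2 (lam p.1 p.2)) 2,
      ∀ p : Weight × ℕ+, ∀ᵐ x ∂lam p.1 p.2, w p x ≠ 0 := by
  have := hlam.finite
  obtain ⟨δ, hδ, c, hc, -⟩ := NNReal.exists_pos_sum_of_countable (one_ne_zero) (Weight × ℕ+)
  let e : ∀ p : Weight × ℕ+, Lp ℂ 2 (lam p.1 p.2) := fun p => Lp.const 2 (lam p.1 p.2) (1 : ℂ)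
  -- This scaling bounds the squared norms by the summable `δ p`; the `1 +` covers summands with
  -- zero measure.
  let t : Weight × ℕ+ → ℝ := fun p => Real.sqrt (δ p) / (1 + ‖e p‖)
  have ht : ∀ p, 0 < t p := fun p =>
    div_pos (Real.sqrt_pos.2 (by exact_mod_cast hδ p)) (by positivity)
  have hnorm : ∀ p, ‖(t p : ℂ) • e p‖ ^ 2 ≤ (δ p : ℝ) := fun p => by
    have h1 : ‖(t p : ℂ) • e p‖ ≤ Real.sqrt (δ p) := by
      rw [norm_smul, Complex.norm_real, Real.norm_of_nonneg (ht p).le, div_mul_eq_mul_div,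
        div_le_iff₀ (by positivity)]
      have := Real.sqrt_nonneg (δ p)
      nlinarith [norm_nonneg (e p)]
    calc ‖(t p : ℂ) • e p‖ ^ 2 ≤ Real.sqrt (δ p) ^ 2 := pow_le_pow_left₀ (norm_nonneg _) h1 2
      _ = δ p := Real.sq_sqrt (δ p).coe_nonneg
  refine ⟨⟨fun p => (t p : ℂ) • e p, memℓp_gen ?_⟩, fun p => ?_⟩
  · simp only [ENNReal.toReal_ofNat, Real.rpow_ofNat]
    exact Summable.of_nonneg_of_le (fun p => by positivity) hnorm
      (NNReal.summable_coe.2 hc.summable)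
  · filter_upwards [Lp.coeFn_smul (t p : ℂ) (e p), Lp.coeFn_const 2 (lam p.1 p.2) (1 : ℂ)]
      with x h1 h2
    rw [h1, Pi.smul_apply, h2]
    simpa using (ht p).ne'

/-- For a vector vanishing almost nowhere, `|w|² dλ` is equivalent to `λ` in every summand, so its
spectral measure dominates all others. -/
theorem exists_isMaximalSpectralType (hlam : IsSoleckiFamily μ lam) (hU : Intertwines U Φ)
    (f : X →ₘ[μ] Circle) (k : ℤ) :
    ∃ σ, IsMaximalSpectralType (Φ f ^ k) σ ∧ ∀ κ, weightMeasure lam f k κ ≪ σ := by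
  obtain ⟨w, hw⟩ := exists_cyclic hlam
  refine ⟨vectorMeasure (fun p => w p) f k, ⟨⟨U.symm w, ?_⟩, fun v ρ hρ => ?_⟩, fun κ => ?_⟩
  · simpa using isSpectralMeasure_vectorMeasure hlam hU f k (U.symm w)
  · rw [hρ.unique (isSpectralMeasure_vectorMeasure hlam hU f k v)]
    refine Measure.absolutelyContinuous_sum_left fun p => ?_
    refine Measure.absolutelyContinuous_sum_right p ?_
    exact ((normSqMeasure_absolutelyContinuous _).trans
      (absolutelyContinuous_normSqMeasure (hw p))).map (measurable_evalPow_zpow f _ k)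
  · refine Measure.absolutelyContinuous_sum_right (κ, 1) ?_
    exact (absolutelyContinuous_normSqMeasure (hw (κ, 1))).map (measurable_evalPow_zpow f _ k)

theorem IsMaximalSpectralType.absolutelyContinuous (hlam : IsSoleckiFamily μ lam)
    (hU : Intertwines U Φ) {f : X →ₘ[μ] Circle} {k : ℤ} {σ : Measure Circle}
    (hσ : IsMaximalSpectralType (Φ f ^ k) σ) : σ ≪ Measure.sum (weightMeasure lam f k) := by
  obtain ⟨⟨v, hv⟩, -⟩ := hσ
  rw [hv.unique (isSpectralMeasure_vectorMeasure hlam hU f k v)]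
  refine Measure.absolutelyContinuous_sum_left fun p => ?_
  refine Measure.absolutelyContinuous_sum_right p.1 ?_
  refine ((normSqMeasure_absolutelyContinuous _).trans ?_).map (measurable_evalPow_zpow f _ k)
  rcases eq_or_lt_of_le (one_le (a := p.2)) with h | h
  · rw [← h]
  · exact hlam.decreasing _ _ _ h

end Spectral

/-! ### Convolutions as images of product measures -/

section Convolution

theorem measurable_finProd (l : ℕ) : Measurable fun z : Fin l → Circle => ∏ i, z i :=
  (continuous_finsetProd _ fun i _ => continuous_apply i).measurable

variable {X : Type*} [MeasurableSpace X] {μ : Measure X}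
  {lam : (κ : Weight) → ℕ+ → Measure (Fin κ.len → X)}

theorem isFiniteMeasure_weightMeasure (hlam : IsSoleckiFamily μ lam) (f : X →ₘ[μ] Circle) (k : ℤ)
    (κ : Weight) : IsFiniteMeasure (weightMeasure lam f k κ) := by
  have := hlam.finite
  unfold weightMeasure
  infer_instance

theorem convolution_weightMeasure (hlam : IsSoleckiFamily μ lam) (f : X →ₘ[μ] Circle) {l : ℕ}
    (k : Fin l → ℤ) (κ : Fin l → Weight) :
    convolution (fun i => weightMeasure lam f (k i) (κ i))
      = (prodMeasure lam κ).map (evalPow f (concat k κ)) := by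
  have := hlam.finite
  unfold convolution weightMeasure prodMeasure
  have hm : Measurable fun (y : ∀ i, Fin (κ i).len → X) i => evalPow f (κ i).entry (y i) ^ k i :=
    measurable_pi_lambda _ fun i =>
      (measurable_evalPow_zpow f _ (k i)).comp (measurable_pi_apply i)
  rw [← Measure.pi_map_pi fun i => (measurable_evalPow_zpow f _ (k i)).aemeasurable,
    Measure.map_map (measurable_finProd l) hm,
    Measure.map_map (measurable_evalPow (AEEqFun.measurable f) _) (measurable_uncurry_concat κ)]
  congr 1
  funext y
  simp only [Function.comp_apply, evalPow, concat, Fintype.prod_sigma, ← Finset.prod_zpow,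
    ← zpow_mul, mul_comm]

theorem convolution_absolutelyContinuous_sum (hlam : IsSoleckiFamily μ lam) (f : X →ₘ[μ] Circle)
    {l : ℕ} (k : Fin l → ℤ) (σ : Fin l → Measure Circle) [∀ i, IsFiniteMeasure (σ i)]
    (hσ : ∀ i, σ i ≪ Measure.sum (weightMeasure lam f (k i))) :
    convolution σ ≪ Measure.sum fun κ : Fin l → Weight =>
      (prodMeasure lam κ).map (evalPow f (concat k κ)) := by
  have := fun i => isFiniteMeasure_weightMeasure hlam f (k i)
  have h := (pi_absolutelyContinuous_sum σ (fun i => weightMeasure lam f (k i)) hσ).map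
    (measurable_finProd l)
  rw [Measure.map_sum (measurable_finProd l).aemeasurable] at h
  simp_rw [← convolution_weightMeasure hlam]
  exact h

end Convolution

/-! ### The two implications -/

section Main

variable {X : Type*} [MeasurableSpace X] {μ : Measure X}
  {H : Type*} [NormedAddCommGroup H] [InnerProductSpace ℂ H] [CompleteSpace H]
  {Φ : (X →ₘ[μ] Circle) →* unitary (H →L[ℂ] H)}
  {lam : (κ : Weight) → ℕ+ → Measure (Fin κ.len → X)}

theorem IsDirectSumOfMultiplications.exists_intertwines (h : IsDirectSumOfMultiplications Φ lam) :
    ∃ U : H ≃ₗᵢ[ℂ] lp (fun p : Weight × ℕ+ => Lp ℂ 2 (lam p.1 p.2)) 2, Intertwines U Φ := h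

theorem DLCondition.orthogonalityRelations [IsFiniteMeasure μ] {K : Set ℤ}
    (hlam : IsSoleckiFamily μ lam) (hsum : IsDirectSumOfMultiplications Φ lam)
    (h : DLCondition K Φ) : OrthogonalityRelations K lam := by
  obtain ⟨U, hU⟩ := hsum.exists_intertwines
  obtain ⟨G, -, hG, hDL⟩ := h
  obtain ⟨f, hf⟩ : G.Nonempty := hG.nonempty
  intro l l' κ κ' r k k' hl hl' hk hk' hkk' hr
  choose σ hσ hσac using exists_isMaximalSpectralType hlam hU f
  have hfin : ∀ m, IsFiniteMeasure (σ m) := fun m => (hσ m).1.choose_spec.1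
  have hwfin := isFiniteMeasure_weightMeasure hlam f
  have hconv : ∀ {l : ℕ} (k : Fin l → ℤ) (κ : Fin l → Weight),
      (prodMeasure lam κ).map (evalPow f (concat k κ)) ≪ convolution fun i => σ (k i) :=
    fun k κ => by
      rw [← convolution_weightMeasure hlam]
      exact (pi_absolutelyContinuous _ _ fun i => hσac (k i) (κ i)).map (measurable_finProd _)
  have hsing := (hDL f hf l l' k k' hl hl' hk hk' hkk' _ _ (fun i => hσ (k i))
    (fun j => hσ (k' j))).mono_ac (hconv k κ) (hconv k' κ')
  have hrm : Measurable fun (x : ConcatIndex κ' → X) p => x (r p) :=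
    measurable_pi_lambda _ fun p => measurable_pi_apply _
  have hT := measurable_evalPow (AEEqFun.measurable f) (concat k κ)
  have hcomp : evalPow f (concat k' κ')
      = evalPow f (concat k κ) ∘ fun (x : ConcatIndex κ' → X) p => x (r p) := by
    funext x
    simp only [evalPow, Function.comp_apply, hr]
    exact (Equiv.prod_comp r fun q => f (x q) ^ concat k' κ' q).symm
  rw [hcomp, ← Measure.map_map hT hrm] at hsing
  -- Both measures are now pushed forward by the same map, so the preimage of the separating set
  -- separates them.
  obtain ⟨s, hs, h1, h2⟩ := hsing
  rw [Measure.map_apply hT hs] at h1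
  rw [Measure.map_apply hT hs.compl] at h2
  exact ⟨_, hT hs, h1, h2⟩

theorem OrthogonalityRelations.dlCondition [StandardBorelSpace X] [IsProbabilityMeasure μ]
    [NullSingletonClass μ] {K : Set ℤ} (hK : (0 : ℤ) ∉ K) (hlam : IsSoleckiFamily μ lam)
    (hsum : IsDirectSumOfMultiplications Φ lam) (h : OrthogonalityRelations K lam) :
    DLCondition K Φ := by
  obtain ⟨U, hU⟩ := hsum.exists_intertwines
  have hfin := fun {l : ℕ} (κ : Fin l → Weight) => isFiniteMeasure_prodMeasure hlam κ
  have hne : ∀ {l : ℕ} (k : Fin l → ℤ) (κ : Fin l → Weight), (∀ i, k i ∈ K) →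
      ∀ p, concat k κ p ≠ 0 := fun k κ hk p =>
    mul_ne_zero (fun h0 => hK (h0 ▸ hk p.1)) ((κ p.1).entry_ne_zero p.2)
  have key : ∀ᶠ f : X →ₘ[μ] Circle in residual (X →ₘ[μ] Circle),
      ∀ (l l' : ℕ) (k : Fin l → ℤ) (k' : Fin l' → ℤ) (κ : Fin l → Weight) (κ' : Fin l' → Weight),
        0 < l → 0 < l' → (∀ i, k i ∈ K) → (∀ j, k' j ∈ K) → ¬ IsRearrangement k k' →
        ((prodMeasure lam κ).map (evalPow f (concat k κ))).MutuallySingular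
          ((prodMeasure lam κ').map (evalPow f (concat k' κ'))) := by
    -- Lengths, tuples and weights range over countable types, so one residual set works for all of
    -- them.
    simp only [eventually_countable_forall]
    intro l l' k k' κ κ' hl hl' hk hk' hkk'
    exact eventually_residual_mutuallySingular (hne k κ hk) (hne k' κ' hk')
      (prodMeasure_marginal hlam κ) (prodMeasure_marginal hlam κ')
      (prodMeasure_diagonal hlam κ) (prodMeasure_diagonal hlam κ')
      fun r hr => h l l' κ κ' r k k' hl hl' hk hk' hkk' hr
  obtain ⟨G, hGs, hG, hGd⟩ := mem_residual.1 key
  refine ⟨G, hG, hGd, fun f hf l l' k k' hl hl' hk hk' hkk' σ σ' hσ hσ' => ?_⟩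
  have hσf : ∀ i, IsFiniteMeasure (σ i) := fun i => (hσ i).1.choose_spec.1
  have hσf' : ∀ i, IsFiniteMeasure (σ' i) := fun i => (hσ' i).1.choose_spec.1
  refine Measure.MutuallySingular.mono_ac ?_
    (convolution_absolutelyContinuous_sum hlam f k σ fun i => (hσ i).absolutelyContinuous hlam hU)
    (convolution_absolutelyContinuous_sum hlam f k' σ' fun i =>
      (hσ' i).absolutelyContinuous hlam hU)
  exact Measure.MutuallySingular.sum_left.2 fun κ => Measure.MutuallySingular.sum_right.2 fun κ' =>
    hGs hf l l' k k' κ κ' hl hl' hk hk' hkk'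

end Main

end SpectralDL

theorem theorem4p5 {X : Type*} [MeasurableSpace X] [StandardBorelSpace X]
    (μ : Measure X) [IsProbabilityMeasure μ] [NullSingletonClass μ]
    {H : Type*} [NormedAddCommGroup H] [InnerProductSpace ℂ H] [CompleteSpace H]
    [TopologicalSpace.SeparableSpace H]
    (Φ : (X →ₘ[μ] Circle) →* unitary (H →L[ℂ] H)) (hΦ : SpectralDL.StronglyContinuous Φ)
    (lam : (κ : SpectralDL.Weight) → ℕ+ → Measure (Fin κ.len → X))
    (hlam : SpectralDL.IsSoleckiFamily μ lam)
    (hsum : SpectralDL.IsDirectSumOfMultiplications Φ lam) :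
    (SpectralDL.DLCondition {k : ℤ | 0 < k} Φ ↔
        SpectralDL.OrthogonalityRelations {k : ℤ | 0 < k} lam) ∧
      (SpectralDL.DLCondition {k : ℤ | k ≠ 0} Φ ↔
        SpectralDL.OrthogonalityRelations {k : ℤ | k ≠ 0} lam) :=
  ⟨⟨fun h => h.orthogonalityRelations hlam hsum, fun h => h.dlCondition (by simp) hlam hsum⟩,
    ⟨fun h => h.orthogonalityRelations hlam hsum, fun h => h.dlCondition (by simp) hlam hsum⟩⟩
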